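/- Let $N,k\ge 0$ be integers, let $(\Omega,\mathcal F,P)$ be a probability space carrying an $N$-dimensional Wiener process $W=(W_t)_{t\ge0}$, $W_0=0$ a.s., and equip it with the natural filtration of $W$ augmented by the $P$-null events. Let $D\subset\mathbb R^k$ be compact, and let $f,h:\mathbb R^N\times D\to\mathbb R$, $i:\mathbb R^N\times D\to\mathbb R^N$ and $g:\mathbb R^N\to\mathbb R$ be continuous. Assume that there are constants $L_1>0$ and $L_2\in\mathbb R\setminus\{0\}$ such that, for $\zeta=f,h,i$ and for all $y,\bar y\in\mathbb R^N$, $\delta\in D$, $$|g(y)-g(\bar y)|\le L_1|y-\bar y|,\qquad |\zeta(y,\delta)-\zeta(\bar y,\delta)|\le L_1|y-\bar y|,\qquad (y-\bar y)\cdot[i(y,\delta)-i(\bar y,\delta)]\le L_2|y-\bar y|^2 .$$ Then for every $T>0$ there exist constants $K_T,M_T>0$ such that for every progressively measurable control process $\delta=(\delta_t)_{t\in[0,T]}$ with values in $D$, every $y\in\mathbb R^N$, every strong solution $Y$ on $[0,T]$ of $$dY_t=i(Y_t,\delta_t)\,dt+dW_t,\qquad Y_0=y,$$ and every $t\in[0,T]$,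 the random variable below is integrable and $$\mathbb E\Big[e^{\int_0^t h(Y_s,\delta_s)\,ds}\max\{|f(Y_t,\delta_t)|,\,|g(Y_t)|,\,1\}\Big]\le K_T\,e^{M_T|y|}.$$ (A strong solution is a process adapted to the augmented filtration, with a.s. continuous paths, that a.s. satisfies the integrated equation $Y_t=y+\int_0^t i(Y_s,\delta_s)\,ds+W_t$ for all $t\in[0,T]$.) -/

import Mathlib

open MeasureTheory ProbabilityTheory
open scoped NNReal

/-- An `N`-dimensional Wiener process (starting at the origin): the coordinates are independent
one-dimensional Brownian motions with almost surely continuous paths. -/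
structure IsWienerProcess {Ω : Type*} [MeasurableSpace Ω] {N : ℕ}
    (W : ℝ≥0 → Ω → EuclideanSpace ℝ (Fin N)) (P : Measure Ω) : Prop where
  measurable : ∀ t, Measurable (W t)
  brownian : ∀ j : Fin N, IsBrownianReal (fun t ω => W t ω j) P
  indep : iIndepFun (fun (j : Fin N) (ω : Ω) (t : ℝ≥0) => W t ω j) P

/-- The augmented natural filtration of a process `W`: at time `t` it is generated by `W s`,
`s ≤ t`, and by all events of probability zero. (If `P` is complete, these are all the sets of
outer measure zero.) -/
def augmentedFiltration {Ω : Type*} {mΩ : MeasurableSpace Ω} {N : ℕ} (P : Measure Ω)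
    (W : ℝ≥0 → Ω → EuclideanSpace ℝ (Fin N)) (hW : ∀ t, Measurable (W t)) :
    Filtration ℝ≥0 mΩ where
  seq t := Filtration.natural W (fun s => (hW s).stronglyMeasurable) t ⊔
    MeasurableSpace.generateFrom {A | MeasurableSet A ∧ P A = 0}
  mono' _ _ hst := sup_le_sup_right (Filtration.mono _ hst) _
  le' t := sup_le (Filtration.le _ t) (MeasurableSpace.generateFrom_le fun _ hA => hA.1)

/-- `δ` is an admissible control on `[0, T]`: it is progressively measurable with respect to `𝓕`
on `[0, T]` and takes values in `D`. Its values after time `T` are irrelevant. -/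
structure IsControl {Ω : Type*} {mΩ : MeasurableSpace Ω} {k : ℕ} (𝓕 : Filtration ℝ≥0 mΩ)
    (D : Set (EuclideanSpace ℝ (Fin k))) (T : ℝ≥0)
    (δ : ℝ≥0 → Ω → EuclideanSpace ℝ (Fin k)) : Prop where
  progressive : ∀ t ≤ T, Measurable[Subtype.instMeasurableSpace.prod (𝓕 t)]
    fun p : Set.Iic t × Ω => δ p.1 p.2
  mem : ∀ t ≤ T, ∀ ω, δ t ω ∈ D

/-- `Y` is a strong solution on `[0, T]` of `dY_t = i(Y_t, δ_t) dt + dW_t`, `Y_0 = y`: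
it is adapted to `𝓕`, its paths are almost surely continuous, and almost surely
`Y_t = y + ∫₀ᵗ i(Y_s, δ_s) ds + W_t` for all `t ∈ [0, T]`. -/
structure IsStrongSolution {Ω : Type*} {mΩ : MeasurableSpace Ω} {N k : ℕ} (P : Measure Ω)
    (𝓕 : Filtration ℝ≥0 mΩ) (W : ℝ≥0 → Ω → EuclideanSpace ℝ (Fin N))
    (i : EuclideanSpace ℝ (Fin N) → EuclideanSpace ℝ (Fin k) → EuclideanSpace ℝ (Fin N))
    (T : ℝ≥0) (δ : ℝ≥0 → Ω → EuclideanSpace ℝ (Fin k)) (y : EuclideanSpace ℝ (Fin N))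
    (Y : ℝ≥0 → Ω → EuclideanSpace ℝ (Fin N)) : Prop where
  adapted : ∀ t ≤ T, Measurable[𝓕 t] (Y t)
  continuous : ∀ᵐ ω ∂P, ContinuousOn (fun t => Y t ω) (Set.Iic T)
  integrable : ∀ᵐ ω ∂P, IntervalIntegrable
    (fun s : ℝ => i (Y s.toNNReal ω) (δ s.toNNReal ω)) volume 0 T
  equation : ∀ᵐ ω ∂P, ∀ t ≤ T,
    Y t ω = y + (∫ s in (0 : ℝ)..t, i (Y s.toNNReal ω) (δ s.toNNReal ω)) + W t ω

/-- The standing assumptions on the coefficients: `f, g, h, i` are continuous (on `ℝᴺ × D`,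
respectively `ℝᴺ`), Lipschitz in the state variable uniformly in the control, and `i` satisfies
a one-sided Lipschitz condition. -/
structure CoefficientAssumptions {N k : ℕ} (D : Set (EuclideanSpace ℝ (Fin k)))
    (f : EuclideanSpace ℝ (Fin N) → EuclideanSpace ℝ (Fin k) → ℝ)
    (g : EuclideanSpace ℝ (Fin N) → ℝ)
    (h : EuclideanSpace ℝ (Fin N) → EuclideanSpace ℝ (Fin k) → ℝ)
    (i : EuclideanSpace ℝ (Fin N) → EuclideanSpace ℝ (Fin k) → EuclideanSpace ℝ (Fin N)) :
    Prop where
  continuous_f : ContinuousOn (Function.uncurry f) (Set.univ ×ˢ D)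
  continuous_g : Continuous g
  continuous_h : ContinuousOn (Function.uncurry h) (Set.univ ×ˢ D)
  continuous_i : ContinuousOn (Function.uncurry i) (Set.univ ×ˢ D)
  lipschitz : ∃ L₁ : ℝ, 0 < L₁ ∧ ∃ L₂ : ℝ, L₂ ≠ 0 ∧
    ∀ y y' : EuclideanSpace ℝ (Fin N), ∀ d ∈ D,
      |g y - g y'| ≤ L₁ * ‖y - y'‖ ∧
      |f y d - f y' d| ≤ L₁ * ‖y - y'‖ ∧
      |h y d - h y' d| ≤ L₁ * ‖y - y'‖ ∧
      ‖i y d - i y' d‖ ≤ L₁ * ‖y - y'‖ ∧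
      inner ℝ (y - y') (i y d - i y' d) ≤ L₂ * ‖y - y'‖ ^ 2

/-! The noise is additive, so for each path `Y - W` solves an integral equation without forcing. The
compactness of `D` and the Lipschitz bounds give linear growth uniform in the control, and Grönwall
yields |Y_t| ≤ (|y| + CT + L∫|W|) e^{LT} + |W_t| (`norm_le_of_integral_equation`). As h, f, g also
grow at most linearly, the reward is at most exp(a₀ + M|y| + c∫|W| + L|W_t|), with constants
independent of control and starting point (`exp_integral_mul_le`).

It remains to see that this exponent, linear in W, has a finite exponential moment. The terms ∫|W|
and |W_t| are separated by e^{u+v} ≤ e^{2u} + e^{2v}; Jensen reduces the time integral to fixed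
times (`lintegral_exp_integral_le`), where the Gaussian law decides
(`IsWienerProcess.exists_lintegral_exp_le`). -/

/-! ### Grönwall's inequality and continuous versions of processes. -/

/-- **Grönwall's inequality** in integral form. -/
theorem le_mul_exp_of_le_add_mul_integral {z : ℝ → ℝ} (hz : Continuous z) {A L T : ℝ}
    (hL : 0 ≤ L) (h : ∀ t ∈ Set.Icc 0 T, z t ≤ A + L * ∫ s in (0 : ℝ)..t, z s) :
    ∀ t ∈ Set.Icc 0 T, z t ≤ A * Real.exp (L * t) := by
  intro t ht
  have hV : ∀ x, HasDerivAt (fun x => ∫ s in (0 : ℝ)..x, z s) (z x) x := fun x =>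
    intervalIntegral.integral_hasDerivAt_right (hz.intervalIntegrable _ _)
      hz.stronglyMeasurable.stronglyMeasurableAtFilter hz.continuousAt
  have hG : ∀ x, HasDerivAt
      (fun x => (A + L * ∫ s in (0 : ℝ)..x, z s) * Real.exp (-(L * x)))
      (L * z x * Real.exp (-(L * x)) +
        (A + L * ∫ s in (0 : ℝ)..x, z s) * (Real.exp (-(L * x)) * -(L * 1))) x := fun x =>
    (((hV x).const_mul L).const_add A).mul (((hasDerivAt_id x).const_mul L).neg.exp)
  -- The derivative is L e^{-Lx} (z(x) - A - L∫₀ˣ z), nonpositive by hypothesis.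
  have hanti : AntitoneOn (fun x => (A + L * ∫ s in (0 : ℝ)..x, z s) * Real.exp (-(L * x)))
      (Set.Icc 0 T) := by
    refine antitoneOn_of_deriv_nonpos (convex_Icc 0 T)
      (fun x _ => (hG x).continuousAt.continuousWithinAt)
      (fun x _ => (hG x).differentiableAt.differentiableWithinAt) fun x hx => ?_
    rw [(hG x).deriv]
    have h1 := h x (interior_subset hx)
    have h2 := mul_nonneg (mul_nonneg hL (sub_nonneg.2 h1)) (Real.exp_pos (-(L * x))).le
    linarith
  have h0 := hanti (Set.left_mem_Icc.2 (ht.1.trans ht.2)) ht ht.1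
  simp only [intervalIntegral.integral_same, mul_zero, add_zero, neg_zero, Real.exp_zero,
    mul_one] at h0
  refine (h t ht).trans ?_
  have h3 := mul_le_mul_of_nonneg_right h0 (Real.exp_pos (L * t)).le
  rwa [mul_assoc, ← Real.exp_add, neg_add_cancel, Real.exp_zero, mul_one] at h3

/-- A process with measurable marginals and almost surely continuous paths on `[0, T]` agrees
there, almost surely, with a jointly measurable process with continuous paths. -/
theorem exists_measurable_continuous_modification {Ω E : Type*} [MeasurableSpace Ω]
    {P : Measure Ω} [TopologicalSpace E] [TopologicalSpace.PseudoMetrizableSpace E]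
    [MeasurableSpace E] [BorelSpace E] [Zero E] {T : ℝ≥0} {X : ℝ≥0 → Ω → E}
    (hX : ∀ t ≤ T, Measurable (X t))
    (hc : ∀ᵐ ω ∂P, ContinuousOn (fun t => X t ω) (Set.Iic T)) :
    ∃ X' : ℝ → Ω → E, Measurable (Function.uncurry X') ∧ (∀ ω, Continuous fun t => X' t ω) ∧
      ∀ᵐ ω ∂P, ∀ t ≤ T, X' t ω = X t ω := by
  classical
  obtain ⟨S, hS, hSm, hSc⟩ := exists_measurable_superset_of_null hc
  -- Paths are set to zero on a measurable null set and frozen outside [0, T].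
  have hcont : ∀ ω, Continuous fun t : ℝ =>
      if ω ∈ S then (0 : E) else X (min t.toNNReal T) ω := by
    intro ω
    by_cases hω : ω ∈ S
    · simpa [hω] using continuous_const
    · have h1 : ContinuousOn (fun t => X t ω) (Set.Iic T) := by
        by_contra h2
        exact hω (hS h2)
      simp only [hω, if_false]
      exact ContinuousOn.comp_continuous h1 (f := fun t : ℝ => min t.toNNReal T) (by fun_prop)
        fun t => Set.mem_Iic.2 (min_le_right _ _)
  refine ⟨fun t ω => if ω ∈ S then 0 else X (min t.toNNReal T) ω,
    measurable_uncurry_of_continuous_of_measurable hcont fun t =>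
      Measurable.ite hSm measurable_const (hX _ (min_le_right _ _)), hcont, ?_⟩
  filter_upwards [measure_eq_zero_iff_ae_notMem.1 hSc] with ω hω t ht
  simp [hω, ht]

/-! ### Exponential moments of the Wiener process. -/

/-- Since e^{c|x|} ≤ e^{cx} + e^{-cx}, two values of the Gaussian moment generating function
suffice. -/
theorem lintegral_exp_mul_abs_le_of_gaussian {Ω : Type*} [MeasurableSpace Ω] {P : Measure Ω}
    [IsProbabilityMeasure P] {X : Ω → ℝ} {v : ℝ≥0} (hX : P.map X = gaussianReal 0 v) (c : ℝ) :
    ∫⁻ ω, ENNReal.ofReal (Real.exp (c * |X ω|)) ∂P ≤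
      ENNReal.ofReal (2 * Real.exp (v * c ^ 2 / 2)) := by
  have hXm : AEMeasurable X P := aemeasurable_of_map_neZero (by rw [hX]; infer_instance)
  have hint : ∀ c : ℝ, Integrable (fun ω => Real.exp (c * X ω)) P := fun c => by
    have := integrable_exp_mul_gaussianReal (μ := 0) (v := v) c
    rw [← hX] at this
    exact this.comp_aemeasurable hXm
  have hmgf : ∀ c : ℝ, ∫ ω, Real.exp (c * X ω) ∂P = Real.exp (v * c ^ 2 / 2) := fun c => by
    simpa [mgf] using mgf_gaussianReal hX c
  calc ∫⁻ ω, ENNReal.ofReal (Real.exp (c * |X ω|)) ∂P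
      ≤ ∫⁻ ω, ENNReal.ofReal (Real.exp (c * X ω) + Real.exp (-c * X ω)) ∂P := by
        refine lintegral_mono fun ω => ENNReal.ofReal_le_ofReal ?_
        rcases abs_choice (X ω) with h | h <;> rw [h]
        · exact le_add_of_nonneg_right (Real.exp_pos _).le
        · rw [mul_neg, neg_mul]
          exact le_add_of_nonneg_left (Real.exp_pos _).le
    _ = ENNReal.ofReal (2 * Real.exp (v * c ^ 2 / 2)) := by
        rw [← ofReal_integral_eq_lintegral_ofReal
          (f := fun ω => Real.exp (c * X ω) + Real.exp (-c * X ω)) ((hint c).add (hint (-c)))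
          (Filter.Eventually.of_forall fun ω => by positivity)]
        congr 1
        rw [integral_add (hint c) (hint (-c)), hmgf, hmgf, neg_sq, two_mul]

/-- The norm is at most N times the largest coordinate; bounding by a sum leaves only
one-dimensional moments. The summand 1 covers N = 0. -/
theorem EuclideanSpace.exp_mul_norm_le {N : ℕ} {c : ℝ} (hc : 0 ≤ c)
    (x : EuclideanSpace ℝ (Fin N)) :
    Real.exp (c * ‖x‖) ≤ 1 + ∑ j, Real.exp (c * N * |x j|) := by
  rcases isEmpty_or_nonempty (Fin N) with hN | hN
  · simp [Subsingleton.elim x 0]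
  obtain ⟨j, -, hj⟩ := Finset.exists_max_image Finset.univ (fun j => |x j|) Finset.univ_nonempty
  have h1 : ‖x‖ ≤ N * |x j| := by
    calc ‖x‖ = ‖∑ j, EuclideanSpace.single j (x j)‖ := by
          congr 1
          ext k
          simp [Pi.single_apply]
      _ ≤ ∑ j, ‖EuclideanSpace.single j (x j)‖ := norm_sum_le _ _
      _ ≤ ∑ _j : Fin N, |x j| := Finset.sum_le_sum fun k hk => by simpa using hj k hk
      _ = N * |x j| := by simp
  calc Real.exp (c * ‖x‖) ≤ Real.exp (c * N * |x j|) := by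
        rw [Real.exp_le_exp, mul_assoc]
        exact mul_le_mul_of_nonneg_left h1 hc
    _ ≤ ∑ j, Real.exp (c * N * |x j|) :=
        Finset.single_le_sum (f := fun j => Real.exp (c * N * |x j|))
          (fun _ _ => (Real.exp_pos _).le) (Finset.mem_univ j)
    _ ≤ _ := by linarith

/-- The exponential moments of the norm of a Wiener process are bounded on bounded time
intervals. -/
theorem IsWienerProcess.exists_lintegral_exp_le {Ω : Type*} [MeasurableSpace Ω] {P : Measure Ω}
    [IsProbabilityMeasure P] {N : ℕ} {W : ℝ≥0 → Ω → EuclideanSpace ℝ (Fin N)}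
    (hW : IsWienerProcess W P) (T : ℝ≥0) {c : ℝ} (hc : 0 ≤ c) :
    ∃ B : ℝ, ∀ t ≤ T,
      ∫⁻ ω, ENNReal.ofReal (Real.exp (c * ‖W t ω‖)) ∂P ≤ ENNReal.ofReal B := by
  refine ⟨1 + ∑ _j : Fin N, 2 * Real.exp (T * (c * N) ^ 2 / 2), fun t ht => ?_⟩
  have hm : ∀ j, Measurable fun ω => ENNReal.ofReal (Real.exp (c * N * |W t ω j|)) := fun j => by
    have := hW.measurable t
    fun_prop
  calc ∫⁻ ω, ENNReal.ofReal (Real.exp (c * ‖W t ω‖)) ∂P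
      ≤ ∫⁻ ω, (1 + ∑ j, ENNReal.ofReal (Real.exp (c * N * |W t ω j|))) ∂P := by
        refine lintegral_mono fun ω => ?_
        rw [← ENNReal.ofReal_one, ← ENNReal.ofReal_sum_of_nonneg fun _ _ => (Real.exp_pos _).le,
          ← ENNReal.ofReal_add zero_le_one (Finset.sum_nonneg fun _ _ => (Real.exp_pos _).le)]
        exact ENNReal.ofReal_le_ofReal (EuclideanSpace.exp_mul_norm_le hc _)
    _ = 1 + ∑ j, ∫⁻ ω, ENNReal.ofReal (Real.exp (c * N * |W t ω j|)) ∂P := by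
        rw [lintegral_add_left measurable_const, lintegral_finsetSum _ fun j _ => hm j]
        simp
    _ ≤ 1 + ∑ _j : Fin N, ENNReal.ofReal (2 * Real.exp (T * (c * N) ^ 2 / 2)) := by
        gcongr with j
        refine (lintegral_exp_mul_abs_le_of_gaussian
          ((hW.brownian j).hasLaw_eval t).map_eq (c * N)).trans
          (ENNReal.ofReal_le_ofReal ?_)
        gcongr
    _ = _ := by
        rw [← ENNReal.ofReal_one, ← ENNReal.ofReal_sum_of_nonneg fun _ _ => by positivity,
          ← ENNReal.ofReal_add zero_le_one (by positivity)]

/-- Exponential moments of a time integral, by Jensen's inequality. -/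
theorem lintegral_exp_integral_le {Ω : Type*} [MeasurableSpace Ω] {P : Measure Ω}
    [IsProbabilityMeasure P] {X : ℝ → Ω → ℝ} (hX : Measurable (Function.uncurry X))
    (hc : ∀ ω, Continuous fun t => X t ω) {T : ℝ} (hT : 0 < T) {c B : ℝ}
    (hB : ∀ t ∈ Set.Ioc 0 T,
      ∫⁻ ω, ENNReal.ofReal (Real.exp (c * T * X t ω)) ∂P ≤ ENNReal.ofReal B) :
    ∫⁻ ω, ENNReal.ofReal (Real.exp (c * ∫ s in (0 : ℝ)..T, X s ω)) ∂P ≤ ENNReal.ofReal B := by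
  have hvol : volume.real (Set.Ioc 0 T) = T := by simp [hT.le]
  have hjensen : ∀ ω, Real.exp (c * ∫ s in (0 : ℝ)..T, X s ω) ≤
      T⁻¹ * ∫ s in Set.Ioc 0 T, Real.exp (c * T * X s ω) := by
    intro ω
    have hcω := hc ω
    have hcX : Continuous fun s => c * T * X s ω := by fun_prop
    -- Jensen for the uniform law on (0, T]: the factor T in the integrand turns its average into
    -- c∫X.
    have h := convexOn_exp.map_set_average_le (μ := volume) (t := Set.Ioc 0 T)
      (f := fun s => c * T * X s ω) Real.continuous_exp.continuousOn isClosed_univ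
      (by simpa using hT) (by simp) (by simp)
      (hcX.integrableOn_Ioc) ((Real.continuous_exp.comp hcX).integrableOn_Ioc)
    rw [setAverage_eq, setAverage_eq, hvol, integral_const_mul, smul_eq_mul, smul_eq_mul] at h
    rw [intervalIntegral.integral_of_le hT.le]
    convert h using 2
    field_simp
  have hofReal : ∀ ω, ENNReal.ofReal (T⁻¹ * ∫ s in Set.Ioc 0 T, Real.exp (c * T * X s ω)) =
      ENNReal.ofReal T⁻¹ * ∫⁻ s in Set.Ioc 0 T, ENNReal.ofReal (Real.exp (c * T * X s ω)) := by
    intro ω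
    have hcω := hc ω
    have hcX : Continuous fun s => Real.exp (c * T * X s ω) := by fun_prop
    rw [ENNReal.ofReal_mul (by positivity), ofReal_integral_eq_lintegral_ofReal
      hcX.integrableOn_Ioc (Filter.Eventually.of_forall fun _ => (Real.exp_pos _).le)]
  have hmeas : Measurable (Function.uncurry fun ω s =>
      ENNReal.ofReal (Real.exp (c * T * X s ω))) := by
    have : Measurable fun p : Ω × ℝ => X p.2 p.1 := hX.comp measurable_swap
    exact (this.const_mul (c * T)).exp.ennreal_ofReal
  calc ∫⁻ ω, ENNReal.ofReal (Real.exp (c * ∫ s in (0 : ℝ)..T, X s ω)) ∂P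
      ≤ ∫⁻ ω, ENNReal.ofReal T⁻¹ *
          (∫⁻ s in Set.Ioc 0 T, ENNReal.ofReal (Real.exp (c * T * X s ω))) ∂P :=
        lintegral_mono fun ω => (ENNReal.ofReal_le_ofReal (hjensen ω)).trans_eq (hofReal ω)
    _ = ENNReal.ofReal T⁻¹ * ∫⁻ s in Set.Ioc 0 T,
          ∫⁻ ω, ENNReal.ofReal (Real.exp (c * T * X s ω)) ∂P := by
        rw [lintegral_const_mul _ hmeas.lintegral_prod_right,
          lintegral_lintegral_swap hmeas.aemeasurable]
    _ ≤ ENNReal.ofReal T⁻¹ * ∫⁻ _s in Set.Ioc 0 T, ENNReal.ofReal B := by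
        gcongr ENNReal.ofReal T⁻¹ * ?_
        exact setLIntegral_mono measurable_const hB
    _ = ENNReal.ofReal B := by
        rw [setLIntegral_const, Real.volume_Ioc, sub_zero, mul_comm, mul_assoc,
          ← ENNReal.ofReal_mul hT.le, mul_inv_cancel₀ hT.ne', ENNReal.ofReal_one, mul_one]

/-! ### Pathwise bounds. -/

/-- A priori bound for an integral equation with additive forcing `w` and a drift of linear
growth. -/
theorem norm_le_of_integral_equation {E : Type*} [NormedAddCommGroup E] [NormedSpace ℝ E]
    {x w b : ℝ → E} (hx : Continuous x) (hw : Continuous w) {y : E} {C L T : ℝ}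
    (hC : 0 ≤ C) (hL : 0 ≤ L) (hb : ∀ s ∈ Set.Icc 0 T, ‖b s‖ ≤ C + L * ‖x s‖)
    (heq : ∀ t ∈ Set.Icc 0 T, x t = y + (∫ s in (0 : ℝ)..t, b s) + w t) :
    ∀ t ∈ Set.Icc 0 T, ‖x t‖ ≤
      (‖y‖ + C * T + L * ∫ s in (0 : ℝ)..T, ‖w s‖) * Real.exp (L * T) + ‖w t‖ := by
  intro t ht
  have hT : 0 ≤ T := ht.1.trans ht.2
  have hint : ∀ {r : ℝ}, r ∈ Set.Icc 0 T →
      ∫ s in (0 : ℝ)..r, ‖w s‖ ≤ ∫ s in (0 : ℝ)..T, ‖w s‖ := fun {r} hr =>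
    intervalIntegral.integral_mono_interval le_rfl hr.1 hr.2
      (Filter.Eventually.of_forall fun _ => norm_nonneg _) (hw.norm.intervalIntegrable _ _)
  have hI : 0 ≤ ∫ s in (0 : ℝ)..T, ‖w s‖ :=
    intervalIntegral.integral_nonneg hT fun _ _ => norm_nonneg _
  have hz : ∀ r ∈ Set.Icc 0 T, ‖x r - w r‖ ≤
      (‖y‖ + C * T + L * ∫ s in (0 : ℝ)..T, ‖w s‖) + L * ∫ s in (0 : ℝ)..r, ‖x s - w s‖ := by
    intro r hr
    have h1 : ‖∫ s in (0 : ℝ)..r, b s‖ ≤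
        ∫ s in (0 : ℝ)..r, (C + L * ‖w s‖ + L * ‖x s - w s‖) := by
      -- Only the dominating function has to be integrable: if `b` is not, its integral is 0 by
      -- convention.
      refine intervalIntegral.norm_integral_le_of_norm_le hr.1
        (Filter.Eventually.of_forall fun s hs => ?_)
        (Continuous.intervalIntegrable (by fun_prop) _ _)
      have h2 : ‖x s‖ ≤ ‖w s‖ + ‖x s - w s‖ := by
        simpa using norm_add_le (w s) (x s - w s)
      have h3 := hb s ⟨hs.1.le, hs.2.trans hr.2⟩
      have h4 := mul_le_mul_of_nonneg_left h2 hL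
      linarith
    rw [intervalIntegral.integral_add (Continuous.intervalIntegrable (by fun_prop) _ _)
        (Continuous.intervalIntegrable (by fun_prop) _ _),
      intervalIntegral.integral_add (Continuous.intervalIntegrable (by fun_prop) _ _)
        (Continuous.intervalIntegrable (by fun_prop) _ _),
      intervalIntegral.integral_const, intervalIntegral.integral_const_mul,
      intervalIntegral.integral_const_mul, sub_zero, smul_eq_mul] at h1
    have h5 : ‖x r - w r‖ ≤ ‖y‖ + ‖∫ s in (0 : ℝ)..r, b s‖ := by
      rw [heq r hr, add_sub_cancel_right]
      exact norm_add_le _ _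
    have h6 := mul_le_mul_of_nonneg_left (hint hr) hL
    have h7 := mul_le_mul_of_nonneg_right hr.2 hC
    linarith
  have h8 := le_mul_exp_of_le_add_mul_integral (hx.sub hw).norm hL hz t ht
  have h9 : ‖x t‖ ≤ ‖x t - w t‖ + ‖w t‖ := by simpa using norm_add_le (x t - w t) (w t)
  have h10 : Real.exp (L * t) ≤ Real.exp (L * T) :=
    Real.exp_le_exp.2 (mul_le_mul_of_nonneg_left ht.2 hL)
  have h11 := mul_le_mul_of_nonneg_left h10
    (show 0 ≤ ‖y‖ + C * T + L * ∫ s in (0 : ℝ)..T, ‖w s‖ by positivity)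
  exact h9.trans (add_le_add_left (h8.trans h11) _)

/-- Bound for an exponential functional of a path that grows at most linearly in the path. -/
theorem exp_integral_mul_le {E : Type*} [NormedAddCommGroup E] {x w : ℝ → E}
    (hw : Continuous w) {H : ℝ → ℝ} {m A C L T t : ℝ} (hA : 0 ≤ A) (hC : 0 ≤ C) (hL : 0 ≤ L)
    (ht : t ∈ Set.Icc 0 T) (hx : ∀ s ∈ Set.Icc 0 T, ‖x s‖ ≤ A + ‖w s‖)
    (hH : ∀ s ∈ Set.Icc 0 T, |H s| ≤ C + L * ‖x s‖) (hm : m ≤ C + 1 + L * ‖x t‖) :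
    Real.exp (∫ s in (0 : ℝ)..t, H s) * m ≤
      Real.exp ((T + 1) * (C + L * A) + 1 + L * (∫ s in (0 : ℝ)..T, ‖w s‖) + L * ‖w t‖) := by
  have h1 : ‖∫ s in (0 : ℝ)..t, H s‖ ≤ ∫ s in (0 : ℝ)..t, (C + L * A + L * ‖w s‖) := by
    refine intervalIntegral.norm_integral_le_of_norm_le ht.1
      (Filter.Eventually.of_forall fun s hs => ?_)
      (Continuous.intervalIntegrable (by fun_prop) _ _)
    have hs' : s ∈ Set.Icc 0 T := ⟨hs.1.le, hs.2.trans ht.2⟩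
    have h2 := mul_le_mul_of_nonneg_left (hx s hs') hL
    have h3 := hH s hs'
    rw [Real.norm_eq_abs]
    linarith
  rw [intervalIntegral.integral_add (Continuous.intervalIntegrable (by fun_prop) _ _)
      (Continuous.intervalIntegrable (by fun_prop) _ _),
    intervalIntegral.integral_const, intervalIntegral.integral_const_mul, sub_zero,
    smul_eq_mul] at h1
  have h4 : ∫ s in (0 : ℝ)..t, ‖w s‖ ≤ ∫ s in (0 : ℝ)..T, ‖w s‖ :=
    intervalIntegral.integral_mono_interval le_rfl ht.1 ht.2
      (Filter.Eventually.of_forall fun _ => norm_nonneg _) (hw.norm.intervalIntegrable _ _)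
  have h5 := mul_le_mul_of_nonneg_left h4 hL
  have h6 := mul_le_mul_of_nonneg_right ht.2 (show 0 ≤ C + L * A by positivity)
  have h7 := (le_abs_self _).trans h1
  have h8 := mul_le_mul_of_nonneg_left (hx t ht) hL
  calc Real.exp (∫ s in (0 : ℝ)..t, H s) * m
      ≤ Real.exp (∫ s in (0 : ℝ)..t, H s) * Real.exp (C + 1 + L * (A + ‖w t‖)) := by
        gcongr
        -- The linear factor moves into the exponent by u ≤ e^u.
        have := Real.add_one_le_exp (C + 1 + L * (A + ‖w t‖))
        linarith
    _ = Real.exp ((∫ s in (0 : ℝ)..t, H s) + (C + 1 + L * (A + ‖w t‖))) := (Real.exp_add _ _).symm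
    _ ≤ _ := by
        rw [Real.exp_le_exp]
        linarith

/-! ### Linear growth of the coefficients and measurability of the reward. -/

/-- Coefficients that are Lipschitz in the state, uniformly over a compact control set, grow at
most linearly in the state, uniformly in the control. -/
theorem CoefficientAssumptions.exists_linear_growth {N k : ℕ}
    {D : Set (EuclideanSpace ℝ (Fin k))} (hD : IsCompact D)
    {f h : EuclideanSpace ℝ (Fin N) → EuclideanSpace ℝ (Fin k) → ℝ}
    {g : EuclideanSpace ℝ (Fin N) → ℝ}
    {i : EuclideanSpace ℝ (Fin N) → EuclideanSpace ℝ (Fin k) → EuclideanSpace ℝ (Fin N)}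
    (hcoef : CoefficientAssumptions D f g h i) :
    ∃ C L : ℝ, 0 ≤ C ∧ 0 < L ∧ ∀ y, ∀ d ∈ D, |f y d| ≤ C + L * ‖y‖ ∧ |g y| ≤ C + L * ‖y‖ ∧
      |h y d| ≤ C + L * ‖y‖ ∧ ‖i y d‖ ≤ C + L * ‖y‖ := by
  obtain ⟨L, hL, _, -, hlip⟩ := hcoef.lipschitz
  have hsec : ∀ {F : Type} [TopologicalSpace F]
      {φ : EuclideanSpace ℝ (Fin N) → EuclideanSpace ℝ (Fin k) → F},
      ContinuousOn (Function.uncurry φ) (Set.univ ×ˢ D) → ContinuousOn (φ 0) D := fun hφ =>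
    hφ.comp (f := fun d => (0, d)) (by fun_prop) fun d hd => ⟨Set.mem_univ _, hd⟩
  obtain ⟨Cf, hCf⟩ := hD.exists_bound_of_continuousOn (hsec hcoef.continuous_f)
  obtain ⟨Ch, hCh⟩ := hD.exists_bound_of_continuousOn (hsec hcoef.continuous_h)
  obtain ⟨Ci, hCi⟩ := hD.exists_bound_of_continuousOn (hsec hcoef.continuous_i)
  refine ⟨|Cf| + |Ch| + |Ci| + |g 0|, L, by positivity, hL, fun y d hd => ?_⟩
  obtain ⟨hg, hf, hh, hi, -⟩ := hlip y 0 d hd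
  rw [sub_zero, ← Real.norm_eq_abs] at hg hf hh
  rw [sub_zero] at hi
  have h1 := norm_le_norm_add_norm_sub' (f y d) (f 0 d)
  have h2 := norm_le_norm_add_norm_sub' (g y) (g 0)
  have h3 := norm_le_norm_add_norm_sub' (h y d) (h 0 d)
  have h4 := norm_le_norm_add_norm_sub' (i y d) (i 0 d)
  have h5 := hCf d hd
  have h6 := hCh d hd
  have h7 := hCi d hd
  have h8 := le_abs_self Cf
  have h9 := le_abs_self Ch
  have h10 := le_abs_self Ci
  have h11 := abs_nonneg Cf
  have h12 := abs_nonneg Ch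
  have h13 := abs_nonneg Ci
  have h14 := abs_nonneg (g 0)
  simp only [Real.norm_eq_abs] at *
  refine ⟨?_, ?_, ?_, ?_⟩ <;> linarith

theorem ContinuousOn.measurable_comp_of_mem {α β γ : Type*} [MeasurableSpace α]
    [TopologicalSpace β] [MeasurableSpace β] [OpensMeasurableSpace β] [TopologicalSpace γ]
    [MeasurableSpace γ] [BorelSpace γ] {φ : β → γ} {s : Set β} (hφ : ContinuousOn φ s) {u : α → β}
    (hu : Measurable u) (hs : ∀ a, u a ∈ s) : Measurable fun a => φ (u a) :=
  (continuousOn_iff_continuous_domRestrict.1 hφ).measurable.comp (hu.subtype_mk (h := hs))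

/-- Freezing the control at T makes progressive measurability at the single time T enough. -/
theorem IsControl.measurable_uncurry {Ω : Type*} {mΩ : MeasurableSpace Ω} {k : ℕ}
    {𝓕 : Filtration ℝ≥0 mΩ} {D : Set (EuclideanSpace ℝ (Fin k))} {T : ℝ≥0}
    {δ : ℝ≥0 → Ω → EuclideanSpace ℝ (Fin k)} (hδ : IsControl 𝓕 D T δ) :
    Measurable fun p : ℝ × Ω => δ (min p.1.toNNReal T) p.2 := by
  have h1 : Measurable fun p : ℝ × Ω =>
      (⟨min p.1.toNNReal T, Set.mem_Iic.2 (min_le_right _ _)⟩ : Set.Iic T) :=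
    Measurable.subtype_mk (by fun_prop)
  have h2 : Measurable[_, 𝓕 T] fun p : ℝ × Ω => p.2 := measurable_snd.mono le_rfl (𝓕.le T)
  let m : MeasurableSpace Ω := 𝓕 T
  exact (hδ.progressive T le_rfl).comp (h1.prodMk h2)

/-- The reward functional of a strong solution is almost everywhere measurable. -/
theorem IsStrongSolution.aestronglyMeasurable_reward {Ω : Type*} {mΩ : MeasurableSpace Ω}
    {P : Measure Ω} {N k : ℕ} {𝓕 : Filtration ℝ≥0 mΩ}
    {W : ℝ≥0 → Ω → EuclideanSpace ℝ (Fin N)} {D : Set (EuclideanSpace ℝ (Fin k))}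
    {f h : EuclideanSpace ℝ (Fin N) → EuclideanSpace ℝ (Fin k) → ℝ}
    {g : EuclideanSpace ℝ (Fin N) → ℝ}
    {i : EuclideanSpace ℝ (Fin N) → EuclideanSpace ℝ (Fin k) → EuclideanSpace ℝ (Fin N)}
    (hcoef : CoefficientAssumptions D f g h i) {T : ℝ≥0}
    {δ : ℝ≥0 → Ω → EuclideanSpace ℝ (Fin k)} (hδ : IsControl 𝓕 D T δ)
    {y : EuclideanSpace ℝ (Fin N)} {Y : ℝ≥0 → Ω → EuclideanSpace ℝ (Fin N)}
    (hY : IsStrongSolution P 𝓕 W i T δ y Y) {t : ℝ≥0} (ht : t ≤ T) :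
    AEStronglyMeasurable (fun ω =>
      Real.exp (∫ s in (0 : ℝ)..t, h (Y s.toNNReal ω) (δ s.toNNReal ω)) *
        max |f (Y t ω) (δ t ω)| (max |g (Y t ω)| 1)) P := by
  have hYm : ∀ t ≤ T, Measurable (Y t) := fun t ht => (hY.adapted t ht).mono (𝓕.le t) le_rfl
  obtain ⟨Y', hY'm, -, hYY'⟩ := exists_measurable_continuous_modification hYm hY.continuous
  have hδm := hδ.measurable_uncurry
  have hH : Measurable fun p : ℝ × Ω => h (Y' p.1 p.2) (δ (min p.1.toNNReal T) p.2) :=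
    hcoef.continuous_h.measurable_comp_of_mem
      (u := fun p : ℝ × Ω => (Y' p.1 p.2, δ (min p.1.toNNReal T) p.2)) (hY'm.prodMk hδm)
      fun p => ⟨Set.mem_univ _, hδ.mem _ (min_le_right _ _) _⟩
  have hint : Measurable fun ω => ∫ s in (0 : ℝ)..t, h (Y' s ω) (δ (min s.toNNReal T) ω) := by
    simp only [intervalIntegral.integral_of_le t.coe_nonneg]
    exact (hH.stronglyMeasurable.integral_prod_left' (μ := volume.restrict (Set.Ioc 0 (t : ℝ))))
      |>.measurable
  have hδt : Measurable (δ t) := by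
    simpa [ht, Function.comp_def] using hδm.comp (measurable_prodMk_left (x := (t : ℝ)))
  have hf : Measurable fun ω => f (Y t ω) (δ t ω) :=
    hcoef.continuous_f.measurable_comp_of_mem (u := fun ω => (Y t ω, δ t ω))
      ((hYm t ht).prodMk hδt) fun ω => ⟨Set.mem_univ _, hδ.mem _ ht _⟩
  have hg : Measurable fun ω => g (Y t ω) := hcoef.continuous_g.measurable.comp (hYm t ht)
  have hmax : Measurable fun ω => max |f (Y t ω) (δ t ω)| (max |g (Y t ω)| 1) :=
    hf.abs.max (hg.abs.max measurable_const)
  refine ⟨_, (hint.exp.mul hmax).stronglyMeasurable, ?_⟩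
  filter_upwards [hYY'] with ω hω
  simp only [Pi.mul_apply]
  congr 2
  refine intervalIntegral.integral_congr fun s hs => ?_
  rw [Set.uIcc_of_le t.coe_nonneg] at hs
  have hsT : s.toNNReal ≤ T := (Real.toNNReal_le_iff_le_coe.2 hs.2).trans ht
  have h1 := hω _ hsT
  rw [Real.coe_toNNReal _ hs.1] at h1
  simp only [h1, min_eq_left hsT]

/-! ### Assembly of the moment bound. -/

theorem IsWienerProcess.ae_continuous {Ω : Type*} [MeasurableSpace Ω] {P : Measure Ω} {N : ℕ}
    {W : ℝ≥0 → Ω → EuclideanSpace ℝ (Fin N)} (hW : IsWienerProcess W P) :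
    ∀ᵐ ω ∂P, Continuous fun t => W t ω := by
  filter_upwards [ae_all_iff.2 fun j => (hW.brownian j).cont] with ω hω
  exact (PiLp.continuous_toLp 2 _).comp (continuous_pi hω)

/-- As U + V ≤ 2 max(U, V), the dependence between ∫|W| and |W_t| plays no role. -/
theorem lintegral_ofReal_exp_add_le {Ω : Type*} [MeasurableSpace Ω] {P : Measure Ω} {U V : Ω → ℝ}
    (hU : Measurable U) {B₁ B₂ : ℝ}
    (h₁ : ∫⁻ ω, ENNReal.ofReal (Real.exp (2 * U ω)) ∂P ≤ ENNReal.ofReal B₁)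
    (h₂ : ∫⁻ ω, ENNReal.ofReal (Real.exp (2 * V ω)) ∂P ≤ ENNReal.ofReal B₂) :
    ∫⁻ ω, ENNReal.ofReal (Real.exp (U ω + V ω)) ∂P ≤ ENNReal.ofReal (|B₁| + |B₂|) := by
  calc ∫⁻ ω, ENNReal.ofReal (Real.exp (U ω + V ω)) ∂P
      ≤ ∫⁻ ω, (ENNReal.ofReal (Real.exp (2 * U ω)) + ENNReal.ofReal (Real.exp (2 * V ω))) ∂P := by
        refine lintegral_mono fun ω => ?_
        rw [← ENNReal.ofReal_add (Real.exp_pos _).le (Real.exp_pos _).le]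
        refine ENNReal.ofReal_le_ofReal ?_
        rcases le_total (U ω) (V ω) with h | h
        · exact (Real.exp_le_exp.2 (by linarith)).trans
            (le_add_of_nonneg_left (Real.exp_pos _).le)
        · exact (Real.exp_le_exp.2 (by linarith)).trans
            (le_add_of_nonneg_right (Real.exp_pos _).le)
    _ = ∫⁻ ω, ENNReal.ofReal (Real.exp (2 * U ω)) ∂P +
          ∫⁻ ω, ENNReal.ofReal (Real.exp (2 * V ω)) ∂P :=
        lintegral_add_left (hU.const_mul 2).exp.ennreal_ofReal _
    _ ≤ ENNReal.ofReal |B₁| + ENNReal.ofReal |B₂| := by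
        gcongr
        · exact h₁.trans (ENNReal.ofReal_le_ofReal (le_abs_self _))
        · exact h₂.trans (ENNReal.ofReal_le_ofReal (le_abs_self _))
    _ = _ := (ENNReal.ofReal_add (abs_nonneg _) (abs_nonneg _)).symm

theorem integrable_and_integral_le_of_le_exp {Ω : Type*} [MeasurableSpace Ω] {P : Measure Ω}
    {F V : Ω → ℝ} (hF : AEStronglyMeasurable F P) (hF0 : ∀ ω, 0 ≤ F ω) {a B : ℝ} (hB : 0 ≤ B)
    (hle : ∀ᵐ ω ∂P, F ω ≤ Real.exp (a + V ω))
    (hV : ∫⁻ ω, ENNReal.ofReal (Real.exp (V ω)) ∂P ≤ ENNReal.ofReal B) :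
    Integrable F P ∧ ∫ ω, F ω ∂P ≤ B * Real.exp a := by
  have h1 : ∫⁻ ω, ENNReal.ofReal (F ω) ∂P ≤ ENNReal.ofReal (B * Real.exp a) := by
    calc ∫⁻ ω, ENNReal.ofReal (F ω) ∂P
        ≤ ∫⁻ ω, ENNReal.ofReal (Real.exp a) * ENNReal.ofReal (Real.exp (V ω)) ∂P := by
          refine lintegral_mono_ae ?_
          filter_upwards [hle] with ω hω
          rw [← ENNReal.ofReal_mul (Real.exp_pos _).le, ← Real.exp_add]
          exact ENNReal.ofReal_le_ofReal hω
      _ = ENNReal.ofReal (Real.exp a) * ∫⁻ ω, ENNReal.ofReal (Real.exp (V ω)) ∂P :=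
          lintegral_const_mul' _ _ ENNReal.ofReal_ne_top
      _ ≤ ENNReal.ofReal (Real.exp a) * ENNReal.ofReal B := by gcongr
      _ = _ := by rw [← ENNReal.ofReal_mul (Real.exp_pos _).le, mul_comm]
  refine ⟨⟨hF, ?_⟩, ?_⟩
  · rw [hasFiniteIntegral_iff_ofReal (Filter.Eventually.of_forall hF0)]
    exact h1.trans_lt ENNReal.ofReal_lt_top
  · rw [integral_eq_lintegral_of_nonneg_ae (Filter.Eventually.of_forall hF0) hF]
    exact ENNReal.toReal_le_of_le_ofReal (by positivity) h1

theorem mainTheorem10 {Ω : Type*} [MeasurableSpace Ω] (P : Measure Ω) [IsProbabilityMeasure P]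
    {N k : ℕ} (W : ℝ≥0 → Ω → EuclideanSpace ℝ (Fin N)) (hW : IsWienerProcess W P)
    (D : Set (EuclideanSpace ℝ (Fin k))) (hD : IsCompact D)
    (f : EuclideanSpace ℝ (Fin N) → EuclideanSpace ℝ (Fin k) → ℝ)
    (g : EuclideanSpace ℝ (Fin N) → ℝ)
    (h : EuclideanSpace ℝ (Fin N) → EuclideanSpace ℝ (Fin k) → ℝ)
    (i : EuclideanSpace ℝ (Fin N) → EuclideanSpace ℝ (Fin k) → EuclideanSpace ℝ (Fin N))
    (hcoef : CoefficientAssumptions D f g h i) (T : ℝ≥0) (hT : 0 < T) :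
    ∃ K M : ℝ, 0 < K ∧ 0 < M ∧
      ∀ δ : ℝ≥0 → Ω → EuclideanSpace ℝ (Fin k),
        IsControl (augmentedFiltration P W hW.measurable) D T δ →
      ∀ (y : EuclideanSpace ℝ (Fin N)) (Y : ℝ≥0 → Ω → EuclideanSpace ℝ (Fin N)),
        IsStrongSolution P (augmentedFiltration P W hW.measurable) W i T δ y Y →
      ∀ t ≤ T,
        Integrable (fun ω =>
          Real.exp (∫ s in (0 : ℝ)..t, h (Y s.toNNReal ω) (δ s.toNNReal ω)) *
            max |f (Y t ω) (δ t ω)| (max |g (Y t ω)| 1)) P ∧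
        ∫ ω, Real.exp (∫ s in (0 : ℝ)..t, h (Y s.toNNReal ω) (δ s.toNNReal ω)) *
            max |f (Y t ω) (δ t ω)| (max |g (Y t ω)| 1) ∂P ≤ K * Real.exp (M * ‖y‖) := by
  obtain ⟨C, L, hC, hL, hgrowth⟩ := hcoef.exists_linear_growth hD
  have hT' : (0 : ℝ) < T := hT
  obtain ⟨W', hW'm, hW'c, hWW'⟩ := exists_measurable_continuous_modification (T := T)
    (fun t _ => hW.measurable t) (hW.ae_continuous.mono fun ω hω => hω.continuousOn)
  -- With A = (|y| + CT + LI)G and I = ∫|W|, the exponent (T+1)(C + LA) + 1 + LI + L|W_t| equals a₀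
  -- + M|y| + cI + L|W_t|; this dictates `M`, `c` and `a₀`.
  set G : ℝ := Real.exp (L * T) with hG
  set M : ℝ := (T + 1) * L * G with hM
  set c : ℝ := M * L + L with hc
  have hGpos : 0 < G := Real.exp_pos _
  have hMpos : 0 < M := by positivity
  have hcpos : 0 < c := by positivity
  set a₀ : ℝ := (T + 1) * C + 1 + M * C * T with ha₀
  -- The factors 2 come from separating the two terms, the factor T from Jensen.
  obtain ⟨B₁, hB₁⟩ := hW.exists_lintegral_exp_le T (c := 2 * c * T) (by positivity)
  obtain ⟨B₂, hB₂⟩ := hW.exists_lintegral_exp_le T (c := 2 * L) (by positivity)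
  have hI : ∫⁻ ω, ENNReal.ofReal (Real.exp (2 * (c * ∫ s in (0 : ℝ)..T, ‖W' s ω‖))) ∂P ≤
      ENNReal.ofReal B₁ := by
    simp only [← mul_assoc]
    refine lintegral_exp_integral_le (X := fun s ω => ‖W' s ω‖) hW'm.norm
      (fun ω => (hW'c ω).norm) hT' fun s hs => ?_
    have hsT : s.toNNReal ≤ T := Real.toNNReal_le_iff_le_coe.2 hs.2
    refine (lintegral_congr_ae ?_).trans_le (hB₁ s.toNNReal hsT)
    filter_upwards [hWW'] with ω hω
    rw [← hω _ hsT, Real.coe_toNNReal _ hs.1.le]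
  have hImeas : Measurable fun ω => c * ∫ s in (0 : ℝ)..T, ‖W' s ω‖ := by
    simp only [intervalIntegral.integral_of_le hT'.le]
    exact (hW'm.norm.stronglyMeasurable.integral_prod_left'
      (μ := volume.restrict (Set.Ioc 0 (T : ℝ)))).measurable.const_mul c
  -- The summand 1 only ensures positivity of the constant.
  refine ⟨(|B₁| + |B₂| + 1) * Real.exp a₀, M, by positivity, hMpos,
    fun δ hδ y Y hY t ht => ?_⟩
  have hV : ∫⁻ ω, ENNReal.ofReal (Real.exp
      (c * (∫ s in (0 : ℝ)..T, ‖W' s ω‖) + L * ‖W t ω‖)) ∂P ≤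
      ENNReal.ofReal (|B₁| + |B₂| + 1) :=
    (lintegral_ofReal_exp_add_le hImeas hI (by simpa only [mul_assoc] using hB₂ t ht)).trans
      (ENNReal.ofReal_le_ofReal (by linarith))
  have hYm : ∀ t ≤ T, Measurable (Y t) := fun t ht =>
    (hY.adapted t ht).mono (Filtration.le _ t) le_rfl
  obtain ⟨Y', -, hY'c, hYY'⟩ := exists_measurable_continuous_modification hYm hY.continuous
  rw [mul_assoc, ← Real.exp_add]
  refine integrable_and_integral_le_of_le_exp (hY.aestronglyMeasurable_reward hcoef hδ ht)
    (fun ω => by positivity) (by positivity) ?_ hV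
  filter_upwards [hWW', hYY', hY.equation] with ω hWω hYω heq
  have hmem : ∀ s ∈ Set.Icc (0 : ℝ) T, s.toNNReal ≤ T := fun s hs =>
    Real.toNNReal_le_iff_le_coe.2 hs.2
  have hY's : ∀ s ∈ Set.Icc (0 : ℝ) T, Y' s ω = Y s.toNNReal ω := fun s hs => by
    rw [← hYω _ (hmem s hs), Real.coe_toNNReal _ hs.1]
  have hW's : ∀ s ∈ Set.Icc (0 : ℝ) T, W' s ω = W s.toNNReal ω := fun s hs => by
    rw [← hWω _ (hmem s hs), Real.coe_toNNReal _ hs.1]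
  have hYbound := norm_le_of_integral_equation (y := y) (C := C) (hY'c ω) (hW'c ω) hC hL.le
    (b := fun s => i (Y s.toNNReal ω) (δ s.toNNReal ω)) (T := T)
    (fun s hs => by
      rw [hY's s hs]
      exact (hgrowth _ _ (hδ.mem _ (hmem s hs) ω)).2.2.2)
    (fun s hs => by
      rw [hY's s hs, hW's s hs, heq _ (hmem s hs), Real.coe_toNNReal _ hs.1])
  have hI0 : 0 ≤ ∫ s in (0 : ℝ)..T, ‖W' s ω‖ :=
    intervalIntegral.integral_nonneg hT'.le fun _ _ => norm_nonneg _
  have htT : (t : ℝ) ∈ Set.Icc (0 : ℝ) T := ⟨t.coe_nonneg, ht⟩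
  obtain ⟨hf, hg, -, -⟩ := hgrowth (Y t ω) _ (hδ.mem t ht ω)
  have hpos : 0 ≤ L * ‖Y t ω‖ := by positivity
  refine (exp_integral_mul_le (x := fun s => Y' s ω) (hW'c ω)
    (H := fun s => h (Y s.toNNReal ω) (δ s.toNNReal ω)) (C := C) (L := L)
    (A := (‖y‖ + C * T + L * ∫ s in (0 : ℝ)..T, ‖W' s ω‖) * G) (by positivity) hC hL.le htT
    hYbound (fun s hs => ?_) ?_).trans ?_
  · rw [hY's s hs]
    exact (hgrowth _ _ (hδ.mem _ (hmem s hs) ω)).2.2.1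
  · rw [hYω t ht]
    exact max_le (by linarith) (max_le (by linarith) (by linarith))
  · rw [hWω t ht, Real.exp_le_exp]
    refine le_of_eq ?_
    rw [hc, ha₀, hM]
    ring
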